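/- Let $\mathcal X$ be a complex Banach space and let $\|\cdot\|_\infty$ denote the operator norm on $\mathcal B(\mathcal X)$. Let $(\mathcal L,\mathcal D(\mathcal L))$ be the generator of a $C_0$-contraction semigroup $(e^{t\mathcal L})_{t\ge0}$ on $\mathcal X$, let $M\in\mathcal B(\mathcal X)$ be a contraction ($\|M\|_\infty\le1$) and let $P\in\mathcal B(\mathcal X)$ be a projection ($P^2=P$) such that $$\|M^n-P\|_\infty\le\tilde c\,\delta^n\qquad\text{for all integers } n\ge1,$$ for some $\delta\in(0,1)$ and $\tilde c\ge0$. Write $P^\perp=\mathbb 1-P$ and $M^\perp=(\mathbb 1-P)M$, and assume that there is $b\ge0$ such that for all $t\ge0$ $$\|Pe^{t\mathcal L}P^\perp\|_\infty\le tb,\qquad \|M^\perp e^{t\mathcal L}-M^\perp\|_\infty\le tb,\qquad \|P^\perp e^{t\mathcal L}P\|_\infty\le tb.$$ Products of unbounded operators have their natural domains, $\mathcal D(\mathcal K\mathcal L)=\{x\in\mathcal D(\mathcal L):\mathcal Lx\in\mathcal D(\mathcal K)\}$. Assume that $(P\mathcal LP,\mathcal D(\mathcal LP))$ generates a $C_0$-semigroup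 $(e^{tP\mathcal LP})_{t\ge0}$ on $\mathcal X$. Then there is $\epsilon>0$ such that for all $t\ge0$ and integers $n\ge1$ with $t\in[0,n\epsilon]$, all $\tilde\delta\in(\delta,1)$ and all $x\in\mathcal D((\mathcal LP)^2)$ $$\left\|\left(Me^{\frac tn\mathcal L}\right)^nx-e^{tP\mathcal LP}Px\right\|\le\frac{c_1}{n}\left(\|x\|+\|\mathcal LPx\|+\|(\mathcal LP)^2x\|\right)+c_2\,\tilde\delta^n\,\|x\|.$$ Here $c_1=c_1(t,b,\tilde\delta-\delta,\tilde c)\ge0$ depends only on $t$, $b$, $\tilde\delta-\delta$ and $\tilde c$, and $c_2=c_2(\tilde c,\tilde\delta-\delta)\ge0$ depends only on $\tilde c$ and $\tilde\delta-\delta$ (neither depends on $\mathcal X$, $\mathcal L$, $M$, $P$, $n$ or $x$). -/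

import Mathlib

open Filter Topology

universe u

namespace Zeno

variable {X : Type u} [NormedAddCommGroup X] [NormedSpace ℂ X]

/-- `(T t)_{t ≥ 0}` is a `C₀`-semigroup of bounded operators on `X`. The family is indexed by `ℝ`,
but only its values at `t ≥ 0` are constrained and only those are ever used. -/
structure IsC0Semigroup (T : ℝ → X →L[ℂ] X) : Prop where
  map_zero : T 0 = 1
  map_add : ∀ s t : ℝ, 0 ≤ s → 0 ≤ t → T (s + t) = T s * T t
  tendsto_zero : ∀ x : X, Tendsto (fun t : ℝ => T t x) (𝓝[≥] 0) (𝓝 x)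

/-- The unbounded operator `L` (with its domain) is the generator of the `C₀`-semigroup `T`:
`x ∈ D(L)` and `L x = y` hold exactly when `(T h x - x) / h → y` as `h ↓ 0`. -/
structure IsGeneratorOf (L : X →ₗ.[ℂ] X) (T : ℝ → X →L[ℂ] X) : Prop where
  isC0Semigroup : IsC0Semigroup T
  mem_graph_iff : ∀ x y : X, (x, y) ∈ L.graph ↔
    Tendsto (fun h : ℝ => ((h : ℂ)⁻¹) • (T h x - x)) (𝓝[>] 0) (𝓝 y)

/-- The composition `K L` of unbounded operators, on the domain
`D(K L) = {x ∈ D(L) | L x ∈ D(K)}`. -/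
def ucomp (K L : X →ₗ.[ℂ] X) : X →ₗ.[ℂ] X where
  domain :=
    { carrier := {x | ∃ hx : x ∈ L.domain, L ⟨x, hx⟩ ∈ K.domain}
      add_mem' := by
        rintro x y ⟨hx, hx'⟩ ⟨hy, hy'⟩
        refine ⟨L.domain.add_mem hx hy, ?_⟩
        have h := L.map_add ⟨x, hx⟩ ⟨y, hy⟩
        have h2 := K.domain.add_mem hx' hy'
        rw [← h] at h2
        exact h2
      zero_mem' := by
        refine ⟨L.domain.zero_mem, ?_⟩
        have h2 := K.domain.zero_mem
        rw [← L.map_zero] at h2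
        exact h2
      smul_mem' := by
        rintro a x ⟨hx, hx'⟩
        refine ⟨L.domain.smul_mem a hx, ?_⟩
        have h := L.map_smul a ⟨x, hx⟩
        have h2 := K.domain.smul_mem a hx'
        rw [← h] at h2
        exact h2 }
  toFun :=
    { toFun := fun x => K ⟨L ⟨x.1, x.2.fst⟩, x.2.snd⟩
      map_add' := by
        rintro ⟨x, hx⟩ ⟨y, hy⟩
        rw [← K.map_add]
        congr 1
        exact Subtype.ext (L.map_add ⟨x, hx.fst⟩ ⟨y, hy.fst⟩)
      map_smul' := by
        rintro a ⟨x, hx⟩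
        rw [RingHom.id_apply, ← K.map_smul]
        congr 1
        exact Subtype.ext (L.map_smul a ⟨x, hx.fst⟩) }

/-- A bounded operator, regarded as an unbounded operator with domain all of `X`. -/
def ofBounded (A : X →L[ℂ] X) : X →ₗ.[ℂ] X := (A : X →ₗ[ℂ] X).toPMap ⊤

end Zeno

/-! Letting `n → ∞` in `M ^ n → P` gives `PM = MP = P` and `‖P‖ ≤ 1`, so the powers of `(1 - P)M = M
- P` decay like `δ ^ n`. Put `s = t / n` and `v k = (M T(s))^k x`. The complementary part `(1 - P) v
k` follows a recursion whose linear part `(1 - P)M T(s)` is an `O(s)` perturbation of `(1 - P)M`,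
hence still decays geometrically, and whose forcing is `O(s)`. It is therefore a geometric term plus
`O(s)`. It feeds back into `P v k` only through `P T(s)(1 - P) = O(s)`; over `n` steps this adds up
to `O(1/n)`. So `(M T(s))^n x` may be replaced by `(P T(s))^n P x` (`IsMixing.norm_pow_sub_pow_le`).

What remains is a Chernoff-type estimate on the range of `P`: `P T(s)` and `S s` differ by `O(s ^
2)` on vectors with two derivatives (`norm_compress_sub_le`). Since `P T(s)` is a contraction and
`S` does not increase the relevant norms, telescoping gives `n * O(s ^ 2) = O(1/n)`. If `s` is too
large for the perturbation argument, the trivial bound `2‖x‖` is already `O(1/n)`. -/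

namespace Zeno

variable {X : Type u} [NormedAddCommGroup X] [NormedSpace ℂ X]

/-! ### `C₀`-semigroups: local bounds, continuity and right derivatives of orbits. -/

/-- `y` is the right derivative at `0` of the orbit of `x` under `T`; for a `C₀`-semigroup this
says that `x` lies in the domain of the generator, which maps it to `y`. -/
def IsGenPair (T : ℝ → X →L[ℂ] X) (x y : X) : Prop :=
  Tendsto (fun h : ℝ => ((h : ℂ)⁻¹) • (T h x - x)) (𝓝[>] 0) (𝓝 y)

theorem ofReal_inv_smul (h : ℝ) (x : X) : ((h : ℂ)⁻¹) • x = h⁻¹ • x := by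
  rw [← Complex.ofReal_inv, Complex.coe_smul]

theorem IsC0Semigroup.exists_bound_near_zero [CompleteSpace X] {T : ℝ → X →L[ℂ] X}
    (hT : IsC0Semigroup T) :
    ∃ η : ℝ, 0 < η ∧ ∃ K : ℝ, 1 ≤ K ∧ ∀ h : ℝ, 0 ≤ h → h ≤ η → ‖T h‖ ≤ K := by
  by_contra! hcon
  have hpos : ∀ n : ℕ, (0 : ℝ) < 1 / ((n : ℝ) + 1) := fun n => by positivity
  choose h h0 h1 h2 using fun n : ℕ =>
    hcon (1 / ((n : ℝ) + 1)) (hpos n) ((n : ℝ) + 1) (by linarith [Nat.cast_nonneg (α := ℝ) n])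
  have hlim : Tendsto h atTop (𝓝[≥] 0) :=
    tendsto_nhdsWithin_iff.2 ⟨squeeze_zero h0 h1 tendsto_one_div_add_atTop_nhds_zero_nat,
      Eventually.of_forall h0⟩
  obtain ⟨C, hC⟩ := banach_steinhaus (g := fun n => T (h n)) (fun x => by
    obtain ⟨C, hC⟩ := ((hT.tendsto_zero x).comp hlim).norm.bddAbove_range
    exact ⟨C, fun n => hC ⟨n, rfl⟩⟩)
  obtain ⟨n, hn⟩ := exists_nat_gt C
  have := h2 n
  have := hC n
  linarith

/-- `S` is not assumed contractive, so left continuity of its orbits needs a bound that is uniform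
on bounded time intervals. -/
theorem IsC0Semigroup.exists_bound [CompleteSpace X] {T : ℝ → X →L[ℂ] X}
    (hT : IsC0Semigroup T) (a : ℝ) :
    ∃ K : ℝ, 0 ≤ K ∧ ∀ r : ℝ, 0 ≤ r → r ≤ a → ‖T r‖ ≤ K := by
  obtain ⟨η, hη, K, hK, hb⟩ := hT.exists_bound_near_zero
  have key : ∀ N : ℕ, ∀ r : ℝ, 0 ≤ r → r ≤ N * η → ‖T r‖ ≤ K ^ N := by
    intro N
    induction N with
    | zero =>
      intro r h0 h1
      have : r = 0 := le_antisymm (by simpa using h1) h0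
      rw [this, hT.map_zero, pow_zero]
      exact ContinuousLinearMap.norm_id_le
    | succ N ih =>
      intro r h0 h1
      push_cast at h1
      rcases le_total r η with h | h
      · exact (hb r h0 h).trans (le_self_pow₀ hK (Nat.succ_ne_zero N))
      · have h2 : T r = T (r - η) * T η := by
          rw [← hT.map_add _ _ (by linarith) hη.le, sub_add_cancel]
        rw [h2, pow_succ]
        refine (norm_mul_le _ _).trans ?_
        have := ih (r - η) (by linarith) (by linarith)
        have := hb η hη.le le_rfl
        gcongr
  obtain ⟨N, hN⟩ := exists_nat_ge (a / η)
  refine ⟨K ^ N, by positivity, fun r h0 h1 => key N r h0 (h1.trans ?_)⟩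
  rwa [div_le_iff₀ hη] at hN

theorem IsC0Semigroup.norm_sub_le {T : ℝ → X →L[ℂ] X}
    (hT : IsC0Semigroup T) {r h : ℝ} (hr : 0 ≤ r) (hh : 0 ≤ h) (x : X) :
    ‖T (r + h) x - T r x‖ ≤ ‖T r‖ * ‖T h x - x‖ := by
  rw [hT.map_add r h hr hh, mul_apply_eq_comp, ← map_sub]
  exact (T r).le_opNorm _

theorem IsC0Semigroup.continuousOn [CompleteSpace X] {T : ℝ → X →L[ℂ] X}
    (hT : IsC0Semigroup T) (x : X) : ContinuousOn (fun r => T r x) (Set.Ici 0) := by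
  intro a ha
  obtain ⟨K, hK, hb⟩ := hT.exists_bound (a + 1)
  rw [Metric.continuousWithinAt_iff]
  intro ε hε
  have h1 := Metric.tendsto_nhdsWithin_nhds.1 (hT.tendsto_zero x) (ε / (K + 1)) (by positivity)
  obtain ⟨d, hd, hd'⟩ := h1
  have key : ∀ r h : ℝ, 0 ≤ r → r ≤ a + 1 → 0 ≤ h → h < d →
      ‖T (r + h) x - T r x‖ < ε := by
    intro r h h0 h1 h2 h3
    have h4 := hd' (x := h) h2 (by simpa [abs_of_nonneg h2] using h3)
    rw [dist_eq_norm] at h4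
    calc _ ≤ ‖T r‖ * ‖T h x - x‖ := hT.norm_sub_le h0 h2 x
      _ ≤ K * ‖T h x - x‖ := by gcongr; exact hb r h0 h1
      _ ≤ (K + 1) * ‖T h x - x‖ := by gcongr; linarith
      _ < (K + 1) * (ε / (K + 1)) := by gcongr
      _ = ε := by field_simp
  refine ⟨min d 1, by positivity, fun r hr hra => ?_⟩
  rw [Real.dist_eq, lt_min_iff, abs_lt] at hra
  rw [dist_eq_norm]
  rcases le_total a r with h | h
  · have := key a (r - a) ha (by linarith) (by linarith) (by linarith)
    rwa [add_sub_cancel] at this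
  · have := key r (a - r) hr (by linarith) (by linarith) (by linarith)
    rwa [add_sub_cancel, norm_sub_rev] at this

theorem IsC0Semigroup.comm {T : ℝ → X →L[ℂ] X} (hT : IsC0Semigroup T) {r h : ℝ} (hr : 0 ≤ r)
    (hh : 0 ≤ h) (x : X) : T h (T r x) = T r (T h x) := by
  have h1 := hT.map_add r h hr hh
  rw [add_comm, hT.map_add h r hh hr] at h1
  exact DFunLike.congr_fun h1 x

theorem IsGenPair.hasDerivWithinAt {T : ℝ → X →L[ℂ] X} (hT : IsC0Semigroup T) {x y : X}
    (h : IsGenPair T x y) {r : ℝ} (hr : 0 ≤ r) :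
    HasDerivWithinAt (fun u => T u x) (T r y) (Set.Ici r) r := by
  rw [← hasDerivWithinAt_Ioi_iff_Ici, hasDerivWithinAt_iff_tendsto_slope' (by simp)]
  have h1 : Tendsto (fun u : ℝ => u - r) (𝓝[>] r) (𝓝[>] 0) := by
    refine tendsto_nhdsWithin_iff.2 ⟨?_, ?_⟩
    · have : Tendsto (fun u : ℝ => u - r) (𝓝 r) (𝓝 (r - r)) := tendsto_id.sub_const r
      rw [sub_self] at this
      exact this.mono_left nhdsWithin_le_nhds
    · filter_upwards [self_mem_nhdsWithin] with u hu
      exact sub_pos.2 (Set.mem_Ioi.1 hu)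
  have h2 := ((T r).continuous.tendsto y).comp (h.comp h1)
  refine h2.congr' ?_
  filter_upwards [self_mem_nhdsWithin] with u hu
  have hu' : 0 ≤ u - r := (sub_pos.2 (Set.mem_Ioi.1 hu)).le
  have h3 := hT.map_add r (u - r) hr hu'
  rw [add_sub_cancel] at h3
  simp only [Function.comp_apply, slope, vsub_eq_sub]
  rw [h3, map_smul, map_sub, mul_apply_eq_comp, ofReal_inv_smul]

theorem IsGenPair.map {T : ℝ → X →L[ℂ] X} (hT : IsC0Semigroup T) {x y : X}
    (h : IsGenPair T x y) {r : ℝ} (hr : 0 ≤ r) : IsGenPair T (T r x) (T r y) := by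
  refine (((T r).continuous.tendsto y).comp h).congr' ?_
  filter_upwards [self_mem_nhdsWithin] with u hu
  simp only [Function.comp_apply]
  rw [map_smul, map_sub, hT.comm hr (le_of_lt hu)]

theorem IsGenPair.sub {T : ℝ → X →L[ℂ] X} {x y x' y' : X} (h : IsGenPair T x y)
    (h' : IsGenPair T x' y') : IsGenPair T (x - x') (y - y') := by
  refine (Tendsto.sub h h').congr fun u => ?_
  rw [← smul_sub, map_sub]
  congr 1
  abel

theorem IsGenPair.smul {T : ℝ → X →L[ℂ] X} {x y : X} (a : ℂ) (h : IsGenPair T x y) :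
    IsGenPair T (a • x) (a • y) := by
  refine (Tendsto.const_smul h a).congr fun u => ?_
  rw [map_smul, ← smul_sub, smul_comm]

/-- A mean value inequality for orbits of a semigroup. -/
theorem IsGenPair.norm_sub_le [CompleteSpace X] {T : ℝ → X →L[ℂ] X} (hT : IsC0Semigroup T)
    {x y : X} (h : IsGenPair T x y) {r C : ℝ} (hr : 0 ≤ r)
    (hC : ∀ u : ℝ, 0 ≤ u → ‖T u y‖ ≤ C) : ‖T r x - x‖ ≤ r * C := by
  have := norm_image_sub_le_of_norm_deriv_right_le_segment (a := 0) (b := r) (C := C)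
    (f := fun u => T u x) (f' := fun u => T u y)
    ((hT.continuousOn x).mono Set.Icc_subset_Ici_self)
    (fun u hu => h.hasDerivWithinAt hT hu.1) (fun u hu => hC u hu.1) r ⟨hr, le_rfl⟩
  simpa [hT.map_zero, mul_comm] using this

/-! ### The compressed semigroup and its approximation by powers of `P T(s)`. -/

/-- `S` is the semigroup generated by the compression `P L P` of the generator `L` of the
contraction semigroup `T` to the range of the contractive projection `P`, and the off-diagonal
blocks of `T t` with respect to `P` are bounded by `t * b`. -/
structure IsCompression (T S : ℝ → X →L[ℂ] X) (P : X →L[ℂ] X) (b : ℝ) : Prop where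
  semigroup : IsC0Semigroup T
  contraction : ∀ t : ℝ, 0 ≤ t → ‖T t‖ ≤ 1
  semigroup' : IsC0Semigroup S
  proj : ∀ x, P (P x) = P x
  proj_norm : ‖P‖ ≤ 1
  nonneg : 0 ≤ b
  upper : ∀ t : ℝ, 0 ≤ t → ‖P * T t * (1 - P)‖ ≤ t * b
  lower : ∀ t : ℝ, 0 ≤ t → ‖(1 - P) * T t * P‖ ≤ t * b
  gen : ∀ x y, IsGenPair S x y ↔ ∃ z, IsGenPair T (P x) z ∧ y = P z

namespace IsCompression

variable {T S : ℝ → X →L[ℂ] X} {P : X →L[ℂ] X} {b : ℝ}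

theorem proj_gen (h : IsCompression T S P b) {x y : X} (hxy : IsGenPair S x y) : P y = y := by
  obtain ⟨z, -, rfl⟩ := (h.gen x y).1 hxy
  exact h.proj z

theorem norm_proj_le (h : IsCompression T S P b) (x : X) : ‖P x‖ ≤ ‖x‖ :=
  (P.le_of_opNorm_le h.proj_norm x).trans_eq (one_mul _)

theorem norm_apply_le (h : IsCompression T S P b) {t : ℝ} (ht : 0 ≤ t) (x : X) :
    ‖T t x‖ ≤ ‖x‖ :=
  ((T t).le_of_opNorm_le (h.contraction t ht) x).trans_eq (one_mul _)

/-- The generator of `S` takes values in the range of `P`, so `(1 - P) S u x` has zero right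
derivative. -/
theorem proj_orbit [CompleteSpace X] (h : IsCompression T S P b) {x y : X}
    (hxy : IsGenPair S x y) (hx : P x = x) {r : ℝ} (hr : 0 ≤ r) : P (S r x) = S r x := by
  have key := norm_image_sub_le_of_norm_deriv_right_le_segment (a := 0) (b := r) (C := 0)
    (f := fun u => S u x - P (S u x)) (f' := fun u => S u y - P (S u y))
    (by
      have hc := (h.semigroup'.continuousOn x).mono (show Set.Icc 0 r ⊆ Set.Ici 0 from Set.Icc_subset_Ici_self)
      exact hc.sub (P.continuous.comp_continuousOn hc))
    (fun u hu => by
      have hd := hxy.hasDerivWithinAt h.semigroup' hu.1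
      exact hd.sub (((P.restrictScalars ℝ).hasFDerivAt).comp_hasDerivWithinAt u hd))
    (fun u hu => by
      rw [h.proj_gen (hxy.map h.semigroup' hu.1), sub_self, norm_zero]) r ⟨hr, le_rfl⟩
  rw [zero_mul, h.semigroup'.map_zero] at key
  simp only [one_apply_eq_self, hx, sub_self, sub_zero] at key
  exact (sub_eq_zero.1 (norm_le_zero_iff.1 key)).symm

/-- On the range of `P`, `S k` agrees to first order in `k` with the contraction `P T(k)`. Hence the
upper right Dini derivative of `‖S u x‖` is at most zero. -/
theorem norm_orbit_le [CompleteSpace X] (h : IsCompression T S P b) {x y : X}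
    (hxy : IsGenPair S x y) (hx : P x = x) {r : ℝ} (hr : 0 ≤ r) : ‖S r x‖ ≤ ‖x‖ := by
  have key := image_le_of_liminf_slope_right_le_deriv_boundary (a := 0) (b := r)
    (f := fun u => ‖S u x‖) (B := fun _ => ‖x‖) (B' := fun _ => 0)
    ((h.semigroup'.continuousOn x).mono Set.Icc_subset_Ici_self).norm
    (by simp [h.semigroup'.map_zero]) continuousOn_const
    (fun u _ => hasDerivWithinAt_const _ _ _)
    (fun u hu ρ hρ => by
      refine Eventually.frequently ?_
      have hu0 : (0 : ℝ) ≤ u := hu.1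
      have hv := hxy.map h.semigroup' hu0
      have hPv := h.proj_orbit hxy hx hu0
      obtain ⟨z, hz, hyz⟩ := (h.gen _ _).1 hv
      rw [hPv] at hz
      have hlim : Tendsto (fun k : ℝ => ((k : ℂ)⁻¹) • (S k (S u x) - P (T k (S u x))))
          (𝓝[>] 0) (𝓝 0) := by
        have := Tendsto.sub hv ((P.continuous.tendsto z).comp hz)
        rw [← hyz, sub_self] at this
        refine this.congr fun k => ?_
        simp only [Function.comp_apply]
        rw [map_smul, map_sub, hPv, ← smul_sub, sub_sub_sub_cancel_right]
      have h1 : Tendsto (fun w : ℝ => w - u) (𝓝[>] u) (𝓝[>] 0) := by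
        refine tendsto_nhdsWithin_iff.2 ⟨?_, ?_⟩
        · have : Tendsto (fun w : ℝ => w - u) (𝓝 u) (𝓝 (u - u)) := tendsto_id.sub_const u
          rw [sub_self] at this
          exact this.mono_left nhdsWithin_le_nhds
        · filter_upwards [self_mem_nhdsWithin] with w hw
          exact sub_pos.2 (Set.mem_Ioi.1 hw)
      have h2 := (hlim.comp h1).norm
      rw [norm_zero] at h2
      filter_upwards [h2.eventually (gt_mem_nhds hρ), self_mem_nhdsWithin] with w hw hw'
      have hw0 : 0 < w - u := sub_pos.2 (Set.mem_Ioi.1 hw')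
      simp only [Function.comp_apply] at hw
      rw [ofReal_inv_smul, norm_smul, norm_inv, Real.norm_of_nonneg hw0.le] at hw
      simp only [slope, vsub_eq_sub, smul_eq_mul]
      refine lt_of_le_of_lt ?_ hw
      gcongr
      have h3 := h.semigroup'.map_add u (w - u) hu0 hw0.le
      rw [add_sub_cancel] at h3
      have h4 : S w x = S (w - u) (S u x) := by
        rw [h.semigroup'.comm hu0 hw0.le, h3, mul_apply_eq_comp]
      rw [h4]
      have h5 : ‖P (T (w - u) (S u x))‖ ≤ ‖S u x‖ :=
        (h.norm_proj_le _).trans (h.norm_apply_le hw0.le _)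
      have h6 := norm_sub_norm_le (S (w - u) (S u x)) (P (T (w - u) (S u x)))
      linarith)
  exact key ⟨hr, le_rfl⟩

/-- `y` need not lie in the domain of the generator of `S`, but the difference quotients of the
orbit of `x` do, and the bound passes to their limit. -/
theorem norm_orbit_gen_le [CompleteSpace X] (h : IsCompression T S P b) {x y : X}
    (hxy : IsGenPair S x y) (hx : P x = x) {r : ℝ} (hr : 0 ≤ r) : ‖S r y‖ ≤ ‖y‖ := by
  refine le_of_tendsto_of_tendsto (((S r).continuous.tendsto y).comp hxy).norm hxy.norm ?_
  filter_upwards [self_mem_nhdsWithin] with k hk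
  have hk0 : (0 : ℝ) ≤ k := le_of_lt hk
  refine h.norm_orbit_le (((hxy.map h.semigroup' hk0).sub hxy).smul _) ?_ hr
  rw [map_smul, map_sub, h.proj_orbit hxy hx hk0, hx]

theorem norm_upper_le (h : IsCompression T S P b) {t : ℝ} (ht : 0 ≤ t) {x : X} (hx : P x = 0) :
    ‖P (T t x)‖ ≤ t * b * ‖x‖ := by
  have := (P * T t * (1 - P)).le_of_opNorm_le (h.upper t ht) x
  simpa [hx] using this

theorem norm_offDiagonal_le (h : IsCompression T S P b) {x z : X} (hxz : IsGenPair T x z)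
    (hx : P x = x) : ‖z - P z‖ ≤ b * ‖x‖ := by
  have h1 := (Tendsto.sub hxz ((P.continuous.tendsto z).comp hxz)).norm
  refine le_of_tendsto h1 ?_
  filter_upwards [self_mem_nhdsWithin] with k hk
  have hk0 : (0 : ℝ) < k := hk
  simp only [Function.comp_apply]
  rw [map_smul, map_sub, hx, ← smul_sub, sub_sub_sub_cancel_right, ofReal_inv_smul, norm_smul,
    norm_inv, Real.norm_of_nonneg hk0.le, inv_mul_le_iff₀ hk0]
  have := ((1 - P) * T k * P).le_of_opNorm_le (h.lower k hk0.le) x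
  simpa [hx, mul_assoc] using this

/-- The difference vanishes at time `0`, and its derivative at time `u` is `O(u)`; the mean value
inequality then gives `O(s ^ 2)`. -/
theorem norm_compress_sub_le [CompleteSpace X] (h : IsCompression T S P b) {x y w : X}
    (hxy : IsGenPair S x y) (hyw : IsGenPair S y w) (hx : P x = x) {s : ℝ} (hs : 0 ≤ s) :
    ‖P (T s x) - S s x‖ ≤ s * (s * (b ^ 2 * ‖x‖ + b * ‖y‖ + 2 * ‖w‖)) := by
  have hb := h.nonneg
  obtain ⟨z, hz, rfl⟩ := (h.gen _ _).1 hxy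
  obtain ⟨v, hv, rfl⟩ := (h.gen _ _).1 hyw
  rw [hx] at hz
  rw [h.proj] at hv
  have hvn : ‖v‖ ≤ ‖P v‖ + b * ‖P z‖ := by
    have h1 := h.norm_offDiagonal_le hv (h.proj z)
    have h2 := norm_add_le (P v) (v - P v)
    rw [add_sub_cancel] at h2
    linarith
  have hzn := h.norm_offDiagonal_le hz hx
  have key := norm_image_sub_le_of_norm_deriv_right_le_segment (a := 0) (b := s)
    (C := s * (b ^ 2 * ‖x‖ + b * ‖P z‖ + 2 * ‖P v‖))
    (f := fun u => P (T u x) - S u x) (f' := fun u => P (T u z) - S u (P z))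
    (by
      have hc := (h.semigroup'.continuousOn x).mono (show Set.Icc 0 s ⊆ Set.Ici 0 from Set.Icc_subset_Ici_self)
      have hc' := (h.semigroup.continuousOn x).mono (show Set.Icc 0 s ⊆ Set.Ici 0 from Set.Icc_subset_Ici_self)
      exact (P.continuous.comp_continuousOn hc').sub hc)
    (fun u hu => by
      have hd := hxy.hasDerivWithinAt h.semigroup' hu.1
      have hd' := hz.hasDerivWithinAt h.semigroup hu.1
      exact (((P.restrictScalars ℝ).hasFDerivAt).comp_hasDerivWithinAt u hd').sub hd)
    (fun u hu => by
      have hu0 : (0 : ℝ) ≤ u := hu.1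
      -- Split `z = P z + (z - P z)`. The off-diagonal part has norm at most `b * ‖x‖` and gains
      -- another factor `u * b` on its way back to the range of `P`; the rest moves by `O(u)`
      -- because `P z` is again in both domains.
      have e : P (T u z) - S u (P z) =
          P (T u (z - P z)) + P (T u (P z) - P z) - (S u (P z) - P z) := by
        simp only [map_sub, h.proj]
        abel
      have h1 : ‖P (T u (z - P z))‖ ≤ u * b * ‖z - P z‖ :=
        h.norm_upper_le hu0 (by rw [map_sub, h.proj, sub_self])
      have h2 : ‖P (T u (P z) - P z)‖ ≤ u * ‖v‖ :=
        (h.norm_proj_le _).trans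
          (hv.norm_sub_le h.semigroup hu0 fun a ha => h.norm_apply_le ha v)
      have h3 : ‖S u (P z) - P z‖ ≤ u * ‖P v‖ :=
        hyw.norm_sub_le h.semigroup' hu0 fun a ha => h.norm_orbit_gen_le hyw (h.proj z) ha
      rw [e]
      calc _ ≤ u * b * ‖z - P z‖ + u * ‖v‖ + u * ‖P v‖ :=
            (norm_sub_le _ _).trans (add_le_add ((norm_add_le _ _).trans (add_le_add h1 h2)) h3)
        _ ≤ u * b * (b * ‖x‖) + u * (‖P v‖ + b * ‖P z‖) + u * ‖P v‖ := by gcongr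
        _ = u * (b ^ 2 * ‖x‖ + b * ‖P z‖ + 2 * ‖P v‖) := by ring
        _ ≤ _ := by gcongr; exact hu.2.le) s ⟨hs, le_rfl⟩
  simp only [h.semigroup.map_zero, h.semigroup'.map_zero, one_apply_eq_self, hx,
    sub_self, sub_zero] at key
  rwa [mul_comm] at key

/-- The local error is incurred first and then carried by the contraction `(P T(s))^n`. The
induction continues at `S s x`, so the vectors vary while `C` stays fixed: `S s` increases none of
the three norms in it. -/
theorem norm_compress_pow_sub_le [CompleteSpace X] (h : IsCompression T S P b) {C s : ℝ}
    (hs : 0 ≤ s) (n : ℕ) : ∀ {x y w : X}, IsGenPair S x y → IsGenPair S y w → P x = x →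
      b ^ 2 * ‖x‖ + b * ‖y‖ + 2 * ‖w‖ ≤ C →
      ‖((P * T s) ^ n) x - S (n * s) x‖ ≤ n * (s * (s * C)) := by
  have hb := h.nonneg
  have hF : ‖P * T s‖ ≤ 1 :=
    (norm_mul_le _ _).trans (mul_le_one₀ h.proj_norm (norm_nonneg _) (h.contraction s hs))
  induction n with
  | zero =>
    intro x y w _ _ _ _
    simp [h.semigroup'.map_zero]
  | succ n ih =>
    intro x y w hxy hyw hx hC
    have h1 := ih (hxy.map h.semigroup' hs) (hyw.map h.semigroup' hs) (h.proj_orbit hxy hx hs)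
      (le_trans (by
        gcongr
        · exact h.norm_orbit_le hxy hx hs
        · exact h.norm_orbit_gen_le hxy hx hs
        · exact h.norm_orbit_gen_le hyw (h.proj_gen hxy) hs) hC)
    have h2 : ‖P (T s x) - S s x‖ ≤ s * (s * C) :=
      (h.norm_compress_sub_le hxy hyw hx hs).trans (by gcongr)
    have h3 : ‖((P * T s) ^ n) (P (T s x) - S s x)‖ ≤ ‖P (T s x) - S s x‖ := by
      refine ((ContinuousLinearMap.le_of_opNorm_le _ ?_ _).trans_eq (one_mul _))
      rcases n.eq_zero_or_pos with rfl | hn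
      · exact ContinuousLinearMap.norm_id_le
      · exact (norm_pow_le' _ hn).trans (pow_le_one₀ (norm_nonneg _) hF)
    have e : ((P * T s) ^ (n + 1)) x - S ((n + 1 : ℕ) * s) x =
        ((P * T s) ^ n) (P (T s x) - S s x) +
          (((P * T s) ^ n) (S s x) - S (n * s) (S s x)) := by
      have : ((n + 1 : ℕ) : ℝ) * s = n * s + s := by push_cast; ring
      rw [this, h.semigroup'.map_add _ _ (by positivity) hs, pow_succ, map_sub]
      simp only [mul_apply_eq_comp]
      abel
    rw [e]
    refine (norm_add_le _ _).trans ?_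
    rw [Nat.cast_succ]
    linarith

end IsCompression

/-! ### Perturbed powers and affine recursions. -/

/-- The prefix `N ^ j` keeps consecutive factors of `N` together, so `K` is paid only once at the
start and once per occurrence of `R`, which gives the rate `δ + K * ‖R‖`. -/
theorem norm_pow_mul_add_pow_le {A : Type*} [NormedRing A] {N R : A} {K δ : ℝ} (hK : 0 ≤ K)
    (hδ : 0 ≤ δ) (hN : ∀ j : ℕ, ‖N ^ j‖ ≤ K * δ ^ j) (k : ℕ) :
    ∀ j : ℕ, ‖N ^ j * (N + R) ^ k‖ ≤ K * δ ^ j * (δ + K * ‖R‖) ^ k := by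
  induction k with
  | zero => simpa using hN
  | succ k ih =>
    intro j
    have e : N ^ j * (N + R) ^ (k + 1) =
        N ^ (j + 1) * (N + R) ^ k + N ^ j * R * (N ^ 0 * (N + R) ^ k) := by
      rw [pow_succ' (N + R), pow_succ, pow_zero, one_mul]
      noncomm_ring
    have h1 := ih (j + 1)
    have h2 : ‖N ^ j * R * (N ^ 0 * (N + R) ^ k)‖ ≤
        K * δ ^ j * ‖R‖ * (K * δ ^ 0 * (δ + K * ‖R‖) ^ k) := by
      refine (norm_mul_le _ _).trans (mul_le_mul ((norm_mul_le _ _).trans ?_) (ih 0)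
        (norm_nonneg _) (by positivity))
      gcongr
      exact hN j
    rw [e]
    calc _ ≤ _ := (norm_add_le _ _).trans (add_le_add h1 h2)
      _ = _ := by ring

theorem geom_sum_le_inv {q : ℝ} (hq : 0 ≤ q) (hq1 : q < 1) (n : ℕ) :
    ∑ i ∈ Finset.range n, q ^ i ≤ (1 - q)⁻¹ := by
  rw [← tsum_geometric_of_lt_one hq hq1]
  exact (summable_geometric_of_lt_one hq hq1).sum_le_tsum _ fun _ _ => by positivity

/-- Duhamel's formula. Only powers of `E` are controlled, so the induction bounds `(E ^ m) (u n)`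
for every `m` rather than estimating one factor at a time. -/
theorem norm_le_of_affine_recursion {E : X →L[ℂ] X} {u g : ℕ → X} {K q γ : ℝ} (hK : 0 ≤ K)
    (hq : 0 ≤ q) (hq1 : q < 1) (hγ : 0 ≤ γ) (hE : ∀ k : ℕ, ‖E ^ k‖ ≤ K * q ^ k)
    (hu : ∀ k, u (k + 1) = E (u k) + g k) (hg : ∀ k, ‖g k‖ ≤ γ) (n : ℕ) :
    ‖u n‖ ≤ K * q ^ n * ‖u 0‖ + K * γ * (1 - q)⁻¹ := by
  have key : ∀ m : ℕ, ‖(E ^ m) (u n)‖ ≤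
      K * q ^ (m + n) * ‖u 0‖ + K * γ * ∑ i ∈ Finset.range n, q ^ (m + i) := by
    induction n with
    | zero =>
      intro m
      simpa using (E ^ m).le_of_opNorm_le (hE m) (u 0)
    | succ n ih =>
      intro m
      have e : (E ^ m) (u (n + 1)) = (E ^ (m + 1)) (u n) + (E ^ m) (g n) := by
        rw [hu, map_add, pow_succ, mul_apply_eq_comp]
      have h1 : ‖(E ^ m) (g n)‖ ≤ K * q ^ m * γ :=
        ((E ^ m).le_of_opNorm_le (hE m) (g n)).trans (by gcongr; exact hg n)
      rw [e, Finset.sum_range_succ']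
      calc _ ≤ _ := (norm_add_le _ _).trans (add_le_add (ih (m + 1)) h1)
        _ = _ := by
          simp only [add_zero, add_assoc, add_comm 1]
          ring
  have h0 := key 0
  simp only [pow_zero, zero_add, one_apply_eq_self] at h0
  refine h0.trans ?_
  gcongr
  exact geom_sum_le_inv hq hq1 n

theorem norm_sub_pow_le_of_affine_recursion {F : X →L[ℂ] X} {u f : ℕ → X} {φ : ℕ → ℝ}
    (hF : ‖F‖ ≤ 1) (hu : ∀ k, u (k + 1) = F (u k) + f k) (hf : ∀ k, ‖f k‖ ≤ φ k) (n : ℕ) :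
    ‖u n - (F ^ n) (u 0)‖ ≤ ∑ k ∈ Finset.range n, φ k := by
  induction n with
  | zero => simp
  | succ n ih =>
    have e : u (n + 1) - (F ^ (n + 1)) (u 0) = F (u n - (F ^ n) (u 0)) + f n := by
      rw [hu, pow_succ', mul_apply_eq_comp, map_sub]
      abel
    rw [e, Finset.sum_range_succ]
    refine (norm_add_le _ _).trans (add_le_add ?_ (hf n))
    exact ((F.le_of_opNorm_le hF _).trans_eq (one_mul _)).trans ih

/-! ### Powers of `M` and of `M T(s)`. -/

/-- `M` is a contraction whose powers converge to the projection `P` at the geometric rate `δ`. -/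
structure IsMixing (M P : X →L[ℂ] X) (c δ : ℝ) : Prop where
  contraction : ‖M‖ ≤ 1
  proj : P * P = P
  rate_pos : 0 < δ
  rate_lt_one : δ < 1
  nonneg : 0 ≤ c
  bound : ∀ n : ℕ, 1 ≤ n → ‖M ^ n - P‖ ≤ c * δ ^ n

namespace IsMixing

variable {M P : X →L[ℂ] X} {c δ : ℝ}

theorem tendsto_pow (h : IsMixing M P c δ) : Tendsto (fun n : ℕ => M ^ n) atTop (𝓝 P) := by
  rw [tendsto_iff_norm_sub_tendsto_zero]
  have h1 : Tendsto (fun n : ℕ => c * δ ^ n) atTop (𝓝 0) := by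
    simpa using (tendsto_pow_atTop_nhds_zero_of_lt_one h.rate_pos.le h.rate_lt_one).const_mul c
  refine squeeze_zero' (Eventually.of_forall fun _ => norm_nonneg _) ?_ h1
  filter_upwards [eventually_ge_atTop 1] with n hn using h.bound n hn

theorem norm_proj_le (h : IsMixing M P c δ) : ‖P‖ ≤ 1 := by
  refine le_of_tendsto h.tendsto_pow.norm ?_
  filter_upwards [eventually_ge_atTop 1] with n hn
  exact (norm_pow_le' M hn).trans (pow_le_one₀ (norm_nonneg _) h.contraction)

theorem proj_mul (h : IsMixing M P c δ) : P * M = P := by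
  have h1 := h.tendsto_pow.mul_const M
  simp only [← pow_succ] at h1
  exact tendsto_nhds_unique h1 (h.tendsto_pow.comp (tendsto_add_atTop_nat 1))

theorem mul_proj (h : IsMixing M P c δ) : M * P = P := by
  have h1 := h.tendsto_pow.const_mul M
  simp only [← pow_succ'] at h1
  exact tendsto_nhds_unique h1 (h.tendsto_pow.comp (tendsto_add_atTop_nat 1))

theorem complement_pow (h : IsMixing M P c δ) (n : ℕ) :
    ((1 - P) * M) ^ (n + 1) = M ^ (n + 1) - P := by
  have e : (1 - P) * M = M - P := by rw [sub_mul, one_mul, h.proj_mul]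
  rw [e]
  induction n with
  | zero => simp
  | succ n ih =>
    have h1 : M ^ (n + 1) * P = P := by
      clear ih
      induction n with
      | zero => simpa using h.mul_proj
      | succ n ih => rw [pow_succ, mul_assoc, h.mul_proj, ih]
    rw [pow_succ, ih, sub_mul, mul_sub, mul_sub, h.proj_mul, h.proj, h1, sub_self, sub_zero,
      ← pow_succ]

theorem norm_complement_pow_le (h : IsMixing M P c δ) (n : ℕ) :
    ‖((1 - P) * M) ^ n‖ ≤ (c + 1) * δ ^ n := by
  have hc := h.nonneg
  have hδ := h.rate_pos
  cases n with
  | zero =>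
    rw [pow_zero, pow_zero]
    -- The power zero is what forces `c + 1` in place of `c`.
    have : ‖(1 : X →L[ℂ] X)‖ ≤ 1 := ContinuousLinearMap.norm_id_le
    linarith
  | succ n =>
    rw [h.complement_pow]
    refine (h.bound _ (Nat.succ_pos n)).trans ?_
    gcongr
    linarith

/-- Alternating `M` with a contraction `U` that couples the ranges of `P` and `1 - P` only weakly
is close to alternating `P` with `U`. -/
theorem norm_pow_sub_pow_le (h : IsMixing M P c δ) {U : X →L[ℂ] X} (hU : ‖U‖ ≤ 1) {β q : ℝ}
    (hβ : 0 ≤ β) (h1 : ‖P * U * (1 - P)‖ ≤ β) (h2 : ‖(1 - P) * M * U - (1 - P) * M‖ ≤ β)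
    (hq : δ + (c + 1) * β ≤ q) (hq1 : q < 1) (n : ℕ) (x : X) :
    ‖((M * U) ^ n) x - ((P * U) ^ n) (P x)‖ ≤
      (c + 1) * (1 - q)⁻¹ * β * (3 + n * β) * ‖x‖ + 2 * (c + 1) * q ^ n * ‖x‖ := by
  have hc := h.nonneg
  have hδ := h.rate_pos
  have hP := h.norm_proj_le
  have hPP : ∀ y, P (P y) = P y := fun y => DFunLike.congr_fun h.proj y
  have hPM : ∀ y, P (M y) = P y := fun y => DFunLike.congr_fun h.proj_mul y
  have hMP : ∀ y, M (P y) = P y := fun y => DFunLike.congr_fun h.mul_proj y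
  have hq0 : 0 ≤ q := le_trans (by positivity) hq
  have hH : 0 < (1 - q)⁻¹ := inv_pos.2 (by linarith)
  set v : ℕ → X := fun k => ((M * U) ^ k) x with hv
  have hv_succ : ∀ k, v (k + 1) = M (U (v k)) := fun k => by
    simp only [hv, pow_succ']
    rfl
  have hv_norm : ∀ k, ‖v k‖ ≤ ‖x‖ := fun k => by
    induction k with
    | zero => simp [hv]
    | succ k ih =>
      rw [hv_succ]
      exact ((M.le_of_opNorm_le h.contraction _).trans_eq (one_mul _)).trans
        (((U.le_of_opNorm_le hU _).trans_eq (one_mul _)).trans ih)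
  have hPv : ∀ k, ‖P (v k)‖ ≤ ‖x‖ := fun k =>
    ((P.le_of_opNorm_le hP _).trans_eq (one_mul _)).trans (hv_norm k)
  have hE : ∀ k : ℕ, ‖((1 - P) * M * U) ^ k‖ ≤ (c + 1) * q ^ k := fun k => by
    have := norm_pow_mul_add_pow_le (N := (1 - P) * M) (R := (1 - P) * M * U - (1 - P) * M)
      (by linarith) hδ.le h.norm_complement_pow_le k 0
    rw [pow_zero, one_mul, pow_zero, mul_one, add_sub_cancel] at this
    refine this.trans ?_
    gcongr
    exact le_trans (by gcongr) hq
  have hQ : ∀ k, ‖v k - P (v k)‖ ≤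
      (c + 1) * q ^ k * (2 * ‖x‖) + (c + 1) * (β * ‖x‖) * (1 - q)⁻¹ := fun k => by
    have hrec := norm_le_of_affine_recursion (E := (1 - P) * M * U) (u := fun k => v k - P (v k))
      (g := fun k => ((1 - P) * M * U - (1 - P) * M) (P (v k))) (K := c + 1) (q := q)
      (γ := β * ‖x‖) (by linarith) hq0 hq1 (by positivity) hE
      -- As `(1 - P) M P = 0`, subtracting `(1 - P) * M` in the forcing term is free and makes it of
      -- size `β`.
      (fun k => by
        simp only [hv_succ, hPM, sub_apply, mul_apply_eq_comp,
          one_apply_eq_self, map_sub, hMP, hPP]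
        abel)
      (fun k => (ContinuousLinearMap.le_of_opNorm_le _ h2 _).trans (by gcongr; exact hPv k)) k
    refine hrec.trans ?_
    gcongr
    have h3 : v 0 = x := by simp [hv]
    have h4 := norm_sub_le (v 0) (P (v 0))
    have h5 := hPv 0
    rw [h3] at h4 h5 ⊢
    linarith
  have hPU : ‖P * U‖ ≤ 1 := (norm_mul_le _ _).trans (mul_le_one₀ hP (norm_nonneg _) hU)
  have hA := norm_sub_pow_le_of_affine_recursion (F := P * U) (u := fun k => P (v k))
    (f := fun k => (P * U * (1 - P)) (v k - P (v k)))
    (φ := fun k => β * ((c + 1) * q ^ k * (2 * ‖x‖) + (c + 1) * (β * ‖x‖) * (1 - q)⁻¹)) hPU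
    (fun k => by
      simp only [hv_succ, hPM, sub_apply, mul_apply_eq_comp,
        one_apply_eq_self, map_sub, hPP]
      abel)
    (fun k => (ContinuousLinearMap.le_of_opNorm_le _ h1 _).trans (by gcongr; exact hQ k)) n
  have hsum : ∑ k ∈ Finset.range n,
      β * ((c + 1) * q ^ k * (2 * ‖x‖) + (c + 1) * (β * ‖x‖) * (1 - q)⁻¹) ≤
      β * ((c + 1) * (1 - q)⁻¹ * (2 * ‖x‖) + n * ((c + 1) * (β * ‖x‖) * (1 - q)⁻¹)) := by
    rw [← Finset.mul_sum, Finset.sum_add_distrib, ← Finset.sum_mul, ← Finset.mul_sum,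
      Finset.sum_const, Finset.card_range, nsmul_eq_mul]
    gcongr
    exact geom_sum_le_inv hq0 hq1 n
  have e : v n - ((P * U) ^ n) (P x) =
      (v n - P (v n)) + (P (v n) - ((P * U) ^ n) (P (v 0))) := by
    have h3 : v 0 = x := by simp [hv]
    rw [h3]
    abel
  change ‖v n - ((P * U) ^ n) (P x)‖ ≤ _
  rw [e]
  calc _ ≤ _ := (norm_add_le _ _).trans (add_le_add (hQ n) (hA.trans hsum))
    _ = _ := by ring

end IsMixing

/-! ### The combined error estimate. -/

theorem IsCompression.norm_pow_sub_le [CompleteSpace X] {T S : ℝ → X →L[ℂ] X}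
    {M P : X →L[ℂ] X} {b c δ δ' t : ℝ} {n : ℕ} {x y w : X} (h : IsCompression T S P b)
    (hM : IsMixing M P c δ)
    (hMT : ∀ t : ℝ, 0 ≤ t → ‖(1 - P) * M * T t - (1 - P) * M‖ ≤ t * b)
    (ht : 0 ≤ t) (hn : 1 ≤ n) (hδ : δ < δ') (hδ' : δ' < 1)
    (hxy : IsGenPair T (P x) y) (hyw : IsGenPair T (P y) w) :
    ‖((M * T (t / n)) ^ n) x - S t (P x)‖ ≤
      ((c + 1) * (2 / (δ' - δ)) * (t * b) * (5 + t * b) + t ^ 2 * (b ^ 2 + b + 2)) / n *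
        (‖x‖ + ‖y‖ + ‖w‖) + 2 * (c + 1) * δ' ^ n * ‖x‖ := by
  have hb := h.nonneg
  have hc := hM.nonneg
  have hδ0 := hM.rate_pos
  have hn0 : (0 : ℝ) < n := by exact_mod_cast hn
  have hd : 0 < δ' - δ := sub_pos.2 hδ
  have hs : 0 ≤ t / n := by positivity
  have hns : (n : ℝ) * (t / n) = t := by field_simp
  have gx : IsGenPair S (P x) (P y) := (h.gen _ _).2 ⟨y, by rwa [h.proj], rfl⟩
  have gy : IsGenPair S (P y) (P w) := (h.gen _ _).2 ⟨w, by rwa [h.proj], rfl⟩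
  have hxP := h.norm_proj_le x
  have hyP := h.norm_proj_le y
  have hwP := h.norm_proj_le w
  have hx0 := norm_nonneg x
  have hy0 := norm_nonneg y
  have hw0 := norm_nonneg w
  have hMT1 : ‖M * T (t / n)‖ ≤ 1 := (norm_mul_le _ _).trans
    (mul_le_one₀ hM.contraction (norm_nonneg _) (h.contraction _ hs))
  have hδ'0 : 0 < δ' := hδ0.trans hδ
  rcases le_or_gt ((c + 1) * (t / n * b)) ((δ' - δ) / 2) with hsmall | hlarge
  -- The midpoint rate leaves room `(δ' - δ) / 2` for the perturbation, and `1 - q ≥ (δ' - δ) / 2`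
  -- keeps the constants dependent on `δ' - δ` alone.
  · have h1 := hM.norm_pow_sub_pow_le (U := T (t / n)) (q := (δ + δ') / 2)
      (h.contraction _ hs) (mul_nonneg hs hb) (h.upper _ hs) (hMT _ hs) (by linarith)
      (by linarith) n x
    have h2 := h.norm_compress_pow_sub_le hs n gx gy (h.proj x)
      (C := (b ^ 2 + b + 2) * (‖x‖ + ‖y‖ + ‖w‖)) (by
        calc _ ≤ b ^ 2 * ‖x‖ + b * ‖y‖ + 2 * ‖w‖ := by gcongr
          _ ≤ b ^ 2 * (‖x‖ + ‖y‖ + ‖w‖) + b * (‖x‖ + ‖y‖ + ‖w‖) +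
              2 * (‖x‖ + ‖y‖ + ‖w‖) := by gcongr <;> linarith
          _ = _ := by ring)
    rw [hns] at h2
    have hinv : (1 - (δ + δ') / 2)⁻¹ ≤ 2 / (δ' - δ) := by
      rw [inv_le_comm₀ (by linarith) (by positivity), inv_div]
      linarith
    have hpos : 0 ≤ (1 - (δ + δ') / 2)⁻¹ := inv_nonneg.2 (by linarith)
    have hmid : (δ + δ') / 2 ≤ δ' := by linarith
    calc _ ≤ _ := norm_sub_le_norm_sub_add_norm_sub _ (((P * T (t / n)) ^ n) (P x)) _
      _ ≤ _ := add_le_add h1 h2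
      _ ≤ ((c + 1) * (2 / (δ' - δ)) * (t / n * b) * (5 + n * (t / n * b)) * (‖x‖ + ‖y‖ + ‖w‖) +
            2 * (c + 1) * δ' ^ n * ‖x‖) +
            n * (t / n * (t / n * ((b ^ 2 + b + 2) * (‖x‖ + ‖y‖ + ‖w‖)))) := by
          gcongr
          · norm_num
          · linarith
      _ = _ := by
          field_simp
          ring
  · have h1 : ‖((M * T (t / n)) ^ n) x‖ ≤ ‖x‖ :=
      (ContinuousLinearMap.le_of_opNorm_le _ ((norm_pow_le' _ hn).trans
        (pow_le_one₀ (norm_nonneg _) hMT1)) x).trans_eq (one_mul _)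
    have h2 : ‖S t (P x)‖ ≤ ‖x‖ := (h.norm_orbit_le gx (h.proj x) ht).trans hxP
    -- A large step makes `4 * (c + 1) * t * b / (n * (δ' - δ))` exceed `2`, so the first term of
    -- the constant absorbs the trivial bound.
    have h3 : 2 ≤ (c + 1) * (2 / (δ' - δ)) * (t * b) * 2 / n := by
      have e : (c + 1) * (2 / (δ' - δ)) * (t * b) * 2 / n =
          4 * ((c + 1) * (t / n * b)) / (δ' - δ) := by
        field_simp
        ring
      rw [e, le_div_iff₀ hd]
      linarith
    calc _ ≤ 2 * ‖x‖ := (norm_sub_le _ _).trans (by linarith)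
      _ ≤ (c + 1) * (2 / (δ' - δ)) * (t * b) * 2 / n * (‖x‖ + ‖y‖ + ‖w‖) := by
          gcongr
          linarith
      _ ≤ ((c + 1) * (2 / (δ' - δ)) * (t * b) * (5 + t * b) + t ^ 2 * (b ^ 2 + b + 2)) / n *
            (‖x‖ + ‖y‖ + ‖w‖) := by
          have h4 : 0 ≤ t ^ 2 * (b ^ 2 + b + 2) := by positivity
          have h5 : (2 : ℝ) ≤ 5 + t * b := by nlinarith [mul_nonneg ht hb]
          have h6 : 0 ≤ (c + 1) * (2 / (δ' - δ)) * (t * b) := by positivity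
          have h7 := mul_le_mul_of_nonneg_left h5 h6
          gcongr
          linarith
      _ ≤ _ := le_add_of_nonneg_right (by positivity)

/-! ### Graphs of products of unbounded operators. -/

theorem mem_graph_ucomp_iff (K L : X →ₗ.[ℂ] X) (x z : X) :
    (x, z) ∈ (ucomp K L).graph ↔ ∃ y, (x, y) ∈ L.graph ∧ (y, z) ∈ K.graph := by
  simp only [LinearPMap.mem_graph_iff]
  constructor
  · rintro ⟨⟨a, ha⟩, rfl, rfl⟩
    exact ⟨_, ⟨⟨a, ha.fst⟩, rfl, rfl⟩, ⟨⟨_, ha.snd⟩, rfl, rfl⟩⟩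
  · rintro ⟨y, ⟨⟨a, ha⟩, rfl, rfl⟩, ⟨⟨a', ha'⟩, h, rfl⟩⟩
    dsimp only at h
    subst h
    exact ⟨⟨a, ha, ha'⟩, rfl, rfl⟩

theorem mem_graph_ofBounded_iff (A : X →L[ℂ] X) (x y : X) :
    (x, y) ∈ (ofBounded A).graph ↔ y = A x := by
  rw [LinearPMap.mem_graph_iff]
  constructor
  · rintro ⟨⟨a, ha⟩, rfl, rfl⟩
    rfl
  · rintro rfl
    exact ⟨⟨x, trivial⟩, rfl, rfl⟩

theorem IsGeneratorOf.mem_graph_ucomp_ofBounded_iff {L : X →ₗ.[ℂ] X} {T : ℝ → X →L[ℂ] X}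
    (hL : IsGeneratorOf L T) (P : X →L[ℂ] X) (x y : X) :
    (x, y) ∈ (ucomp L (ofBounded P)).graph ↔ IsGenPair T (P x) y := by
  rw [mem_graph_ucomp_iff]
  simp only [mem_graph_ofBounded_iff, exists_eq_left]
  exact hL.mem_graph_iff _ _

end Zeno

theorem mainTheorem4 :
    ∃ (c₁ : ℝ → ℝ → ℝ → ℝ → ℝ) (c₂ : ℝ → ℝ → ℝ),
      (∀ t b d c, 0 ≤ c₁ t b d c) ∧ (∀ c d, 0 ≤ c₂ c d) ∧
      ∀ (X : Type u) [NormedAddCommGroup X] [NormedSpace ℂ X] [CompleteSpace X]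
        (L : X →ₗ.[ℂ] X) (T S : ℝ → X →L[ℂ] X) (M P : X →L[ℂ] X) (δ c b : ℝ),
        -- `L` generates the contraction semigroup `T`
        Zeno.IsGeneratorOf L T →
        (∀ t : ℝ, 0 ≤ t → ‖T t‖ ≤ 1) →
        -- `M` is a contraction whose powers converge uniformly to the projection `P`
        ‖M‖ ≤ 1 →
        P * P = P →
        0 < δ → δ < 1 → 0 ≤ c →
        (∀ n : ℕ, 1 ≤ n → ‖M ^ n - P‖ ≤ c * δ ^ n) →
        -- asymptotic Zeno conditions
        0 ≤ b →
        (∀ t : ℝ, 0 ≤ t → ‖P * T t * (1 - P)‖ ≤ t * b) →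
        (∀ t : ℝ, 0 ≤ t → ‖(1 - P) * M * T t - (1 - P) * M‖ ≤ t * b) →
        (∀ t : ℝ, 0 ≤ t → ‖(1 - P) * T t * P‖ ≤ t * b) →
        -- `(P L P, D(L P))` generates the semigroup `S`
        Zeno.IsGeneratorOf
          (Zeno.ucomp (Zeno.ofBounded P) (Zeno.ucomp L (Zeno.ofBounded P))) S →
        ∃ ε : ℝ, 0 < ε ∧
          ∀ (t : ℝ) (n : ℕ) (δ' : ℝ), 0 ≤ t → 1 ≤ n → t ≤ n * ε → δ < δ' → δ' < 1 →
          ∀ (x : X) (hx : x ∈ (Zeno.ucomp L (Zeno.ofBounded P)).domain)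
            (hx₂ : x ∈ (Zeno.ucomp (Zeno.ucomp L (Zeno.ofBounded P))
              (Zeno.ucomp L (Zeno.ofBounded P))).domain),
            ‖((M * T (t / n)) ^ n) x - S t (P x)‖ ≤
              c₁ t b (δ' - δ) c / n *
                  (‖x‖ + ‖(Zeno.ucomp L (Zeno.ofBounded P)) ⟨x, hx⟩‖ +
                    ‖(Zeno.ucomp (Zeno.ucomp L (Zeno.ofBounded P))
                      (Zeno.ucomp L (Zeno.ofBounded P))) ⟨x, hx₂⟩‖) +
                c₂ c (δ' - δ) * δ' ^ n * ‖x‖ := by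
  -- The absolute values only secure nonnegativity at arguments outside the range of interest.
  refine ⟨fun t b d c =>
      |(c + 1) * (2 / d) * (t * b) * (5 + t * b) + t ^ 2 * (b ^ 2 + b + 2)|,
    fun c _ => |2 * (c + 1)|, fun _ _ _ _ => abs_nonneg _, fun _ _ => abs_nonneg _, ?_⟩
  intro X _ _ _ L T S M P δ c b hL hT hM hP hδ0 hδ1 hc hMP hb hPQ hMT hQP hS
  have mix : Zeno.IsMixing M P c δ := ⟨hM, hP, hδ0, hδ1, hc, hMP⟩
  have comp : Zeno.IsCompression T S P b :=
    { semigroup := hL.isC0Semigroup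
      contraction := hT
      semigroup' := hS.isC0Semigroup
      proj := fun x => DFunLike.congr_fun hP x
      proj_norm := mix.norm_proj_le
      nonneg := hb
      upper := hPQ
      lower := hQP
      gen := fun x y => by
        refine (hS.mem_graph_iff x y).symm.trans ?_
        rw [Zeno.mem_graph_ucomp_iff]
        simp only [hL.mem_graph_ucomp_ofBounded_iff, Zeno.mem_graph_ofBounded_iff] }
  refine ⟨1, one_pos, fun t n δ' ht hn _ hδ hδ' x hx hx₂ => ?_⟩
  have g1 := (hL.mem_graph_ucomp_ofBounded_iff P _ _).1
    ((Zeno.ucomp L (Zeno.ofBounded P)).mem_graph ⟨x, hx⟩)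
  have g2 := (hL.mem_graph_ucomp_ofBounded_iff P _ _).1
    ((Zeno.ucomp L (Zeno.ofBounded P)).mem_graph
      ⟨(Zeno.ucomp L (Zeno.ofBounded P)) ⟨x, hx⟩, hx₂.snd⟩)
  have hd : 0 < δ' - δ := sub_pos.2 hδ
  have key := comp.norm_pow_sub_le mix hMT ht hn hδ hδ' g1 g2
  have hδ'0 : 0 < δ' := hδ0.trans hδ
  exact key.trans (add_le_add
    (mul_le_mul_of_nonneg_right (div_le_div_of_nonneg_right (le_abs_self _) n.cast_nonneg)
      (by positivity))
    (mul_le_mul_of_nonneg_right (mul_le_mul_of_nonneg_right (le_abs_self _) (by positivity))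
      (norm_nonneg _)))
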